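/- Let $d\in\mathbb N$, $0<n\le d$, $C_0>0$, $1<\eta\le\alpha<\infty$ and $\beta>\alpha^{d}$. Let $\mu$ be a positive Radon measure on $\mathbb R^d$, not assumed doubling, with $\mu(Q(x,l))\le C_0\,l^{n}$ for all $x\in\mathbb R^d$, $l>0$, where $Q(x,l)$ is the closed cube with center $x$, side length $l$ and sides parallel to the axes. For a cube $Q$ (of this kind, with positive side length $l(Q)$) and $t>0$, $tQ$ is the concentric cube with side length $t\,l(Q)$. $Q$ is $(\alpha,\beta)$-doubling if $\mu(\alpha Q)\le\beta\mu(Q)$. $\widetilde Q$ is the smallest $(\alpha,\beta)$-doubling cube among $\alpha^{m}Q$, $m=0,1,2,\dots$, and $Q'$ is the biggest one among $\alpha^{-N}Q$, $N=1,2,\dots$ (if there is one). Put $\mathscr Q=\{Q: l(Q)\le1\}$ and $\mathscr Q_{ex}=\{Q: Q'\text{ exists and } l(Q')\le1\}$. Further $m_Qf=\frac1{\mu(Q)}\int_Qf\,d\mu$ if $\mu(Q)>0$, and for cubes $Q\subset R$ $$K_{Q,R}=1+\sum_{k=1}^{N_{Q,R}}\frac{\mu(2^kQ)}{l(2^kQ)^n},$$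 where $N_{Q,R}$ is the least $k\in\{0,1,2,\dots\}$ with $l(2^kQ)\ge l(R)$. A real function $f\in L_{loc}(\mu)$ is in $rbmo(\mu)$ if for some $A\ge0$: (a) $\frac1{\mu(\eta Q)}\int_Q|f-m_{\widetilde Q}f|\,d\mu\le A$ for every cube $Q$ with $l(Q)\le1$; (b) $|m_Qf-m_Rf|\le A\,K_{Q,R}$ for all $(\alpha,\beta)$-doubling cubes $Q\subset R$ with $l(Q)\le1$; (c) $\frac1{\mu(\eta Q)}\int_Q|f|\,d\mu\le A$ for every cube $Q$ with $l(Q)>1$. It is in $rbmo^1_{\mathscr Q}(\mu)$ if for some $A\ge0$ condition (a) holds, (b) holds for all $(\alpha,\beta)$-doubling cubes $Q\subset R$ with $Q\in\mathscr Q$ and $R\in\mathscr Q_{ex}$, and (c) holds for all $Q\in\mathscr Q_{ex}\setminus\mathscr Q$. Conditions (a) and (c) are void for $\mu(Q)=0$, and (b) is imposed only if $\mu(Q)>0$. The norms $\|f\|_{rbmo(\mu)}$ and $\|f\|_{*1}$ are the infima of the respective admissible constants $A$. Then $rbmo^{1}_{\mathscr Q}(\mu)=rbmo(\mu)$ with equivalent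 norms: there is a constant $C>0$, depending only on $d,n,C_0,\alpha,\beta,\eta$, such that for every such $\mu$ the two spaces coincide and every $f$ in them satisfies $$\|f\|_{*1}\le C\,\|f\|_{rbmo(\mu)}\quad\text{and}\quad\|f\|_{rbmo(\mu)}\le C\,\|f\|_{*1}.$$ -/

import Mathlib

open MeasureTheory

noncomputable section

namespace NonDoubling

/-- A closed cube of `ℝ^d` with sides parallel to the axes, given by its center and side length.
Degenerate data are excluded by asking `0 < Q.side` wherever cubes are quantified over. -/
structure Cube (d : ℕ) where
  center : Fin d → ℝ
  side : ℝ

namespace Cube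

variable {d : ℕ}

/-- The points of the closed cube `Q`. -/
def toSet (Q : Cube d) : Set (Fin d → ℝ) :=
  {x | ∀ i, |x i - Q.center i| ≤ Q.side / 2}

/-- The concentric cube `t Q` with side length `t * l(Q)`. -/
def scale (t : ℝ) (Q : Cube d) : Cube d := ⟨Q.center, t * Q.side⟩

end Cube

/-- The growth condition `μ(Q(x, l)) ≤ C₀ l^n` for all `x` and all `l > 0`. (It makes the Borel
measure `μ` finite on compact sets, hence Radon.) -/
def Growth {d : ℕ} (μ : Measure (Fin d → ℝ)) (C₀ n : ℝ) : Prop :=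
  ∀ Q : Cube d, 0 < Q.side → μ Q.toSet ≤ ENNReal.ofReal (C₀ * Q.side ^ n)

/-- `Q` is `(α, β)`-doubling: `μ(α Q) ≤ β μ(Q)`. -/
def IsDoubling {d : ℕ} (μ : Measure (Fin d → ℝ)) (α β : ℝ) (Q : Cube d) : Prop :=
  μ.real (Q.scale α).toSet ≤ β * μ.real Q.toSet

/-- `Q̃`, the smallest `(α, β)`-doubling cube among `α^m Q`, `m = 0, 1, 2, …`. -/
def tilde {d : ℕ} (μ : Measure (Fin d → ℝ)) (α β : ℝ) (Q : Cube d) : Cube d :=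
  Q.scale (α ^ sInf {m : ℕ | IsDoubling μ α β (Q.scale (α ^ m))})

/-- The family `𝒬 = {Q : l(Q) ≤ 1}`. -/
def SmallCubes (d : ℕ) : Set (Cube d) := {Q | 0 < Q.side ∧ Q.side ≤ 1}

/-- The family `𝒬_ex = {Q : l(Q') ≤ 1}`, where `Q'` is the biggest `(α, β)`-doubling cube among
`α^(-N) Q`, `N = 1, 2, 3, …`; the biggest cube is the one with the least `N`.
Membership includes that `Q'` exists. -/
def ExCubes {d : ℕ} (μ : Measure (Fin d → ℝ)) (α β : ℝ) : Set (Cube d) :=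
  {Q | 0 < Q.side ∧ ∃ N : ℕ,
    IsLeast {k : ℕ | 1 ≤ k ∧ IsDoubling μ α β (Q.scale (α ^ k)⁻¹)} N ∧
    (Q.scale (α ^ N)⁻¹).side ≤ 1}

/-- The mean `m_Q f` of `f` over `Q`. -/
def mean {d : ℕ} (μ : Measure (Fin d → ℝ)) (f : (Fin d → ℝ) → ℝ) (Q : Cube d) : ℝ :=
  (∫ x in Q.toSet, f x ∂μ) / μ.real Q.toSet

/-- `N_{Q,R}`, the first `k` with `l(2^k Q) ≥ l(R)`. -/
def coeffN {d : ℕ} (Q R : Cube d) : ℕ := sInf {k : ℕ | R.side ≤ (Q.scale (2 ^ k)).side}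

/-- The coefficient `K_{Q,R} = 1 + ∑_{k=1}^{N_{Q,R}} μ(2^k Q) / l(2^k Q)^n`. -/
def coeffK {d : ℕ} (μ : Measure (Fin d → ℝ)) (n : ℝ) (Q R : Cube d) : ℝ :=
  1 + ∑ k ∈ Finset.Icc 1 (coeffN Q R),
    μ.real (Q.scale (2 ^ k)).toSet / (Q.scale (2 ^ k)).side ^ n

/-- `C` is an admissible constant for `f` in the definition of `rbmo(μ)`. In the second condition
`0 < μ(Q)` says that the means `m_Q f` and `m_R f` are defined. -/
structure IsRbmoBound {d : ℕ} (μ : Measure (Fin d → ℝ)) (n α β η : ℝ)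
    (f : (Fin d → ℝ) → ℝ) (C : ℝ) : Prop where
  nonneg : 0 ≤ C
  oscillation : ∀ Q : Cube d, 0 < Q.side → Q.side ≤ 1 →
    (∫ x in Q.toSet, |f x - mean μ f (tilde μ α β Q)| ∂μ) / μ.real (Q.scale η).toSet ≤ C
  means : ∀ Q R : Cube d, 0 < Q.side → 0 < R.side → Q.toSet ⊆ R.toSet →
    IsDoubling μ α β Q → IsDoubling μ α β R → 0 < μ.real Q.toSet → Q.side ≤ 1 →
    |mean μ f Q - mean μ f R| ≤ C * coeffK μ n Q R
  large : ∀ Q : Cube d, 1 < Q.side →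
    (∫ x in Q.toSet, |f x| ∂μ) / μ.real (Q.scale η).toSet ≤ C

/-- `C` is an admissible constant for `f` in the definition of `rbmo¹_𝒬(μ)`. -/
structure IsRbmoOneBound {d : ℕ} (μ : Measure (Fin d → ℝ)) (n α β η : ℝ)
    (f : (Fin d → ℝ) → ℝ) (C : ℝ) : Prop where
  nonneg : 0 ≤ C
  oscillation : ∀ Q ∈ SmallCubes d,
    (∫ x in Q.toSet, |f x - mean μ f (tilde μ α β Q)| ∂μ) / μ.real (Q.scale η).toSet ≤ C
  means : ∀ Q ∈ SmallCubes d, ∀ R ∈ ExCubes μ α β, Q.toSet ⊆ R.toSet →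
    IsDoubling μ α β Q → IsDoubling μ α β R → 0 < μ.real Q.toSet →
    |mean μ f Q - mean μ f R| ≤ C * coeffK μ n Q R
  large : ∀ Q ∈ ExCubes μ α β \ SmallCubes d,
    (∫ x in Q.toSet, |f x| ∂μ) / μ.real (Q.scale η).toSet ≤ C

/-- The space `rbmo(μ)`. -/
def rbmo {d : ℕ} (μ : Measure (Fin d → ℝ)) (n α β η : ℝ) : Set ((Fin d → ℝ) → ℝ) :=
  {f | LocallyIntegrable f μ ∧ ∃ C, IsRbmoBound μ n α β η f C}

/-- The norm of `rbmo(μ)`: the infimum of the admissible constants. -/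
def rbmoNorm {d : ℕ} (μ : Measure (Fin d → ℝ)) (n α β η : ℝ) (f : (Fin d → ℝ) → ℝ) : ℝ :=
  sInf {C | IsRbmoBound μ n α β η f C}

/-- The space `rbmo¹_𝒬(μ)`. -/
def rbmoOne {d : ℕ} (μ : Measure (Fin d → ℝ)) (n α β η : ℝ) : Set ((Fin d → ℝ) → ℝ) :=
  {f | LocallyIntegrable f μ ∧ ∃ C, IsRbmoOneBound μ n α β η f C}

/-- The norm of `rbmo¹_𝒬(μ)`: the infimum of the admissible constants. -/
def rbmoOneNorm {d : ℕ} (μ : Measure (Fin d → ℝ)) (n α β η : ℝ) (f : (Fin d → ℝ) → ℝ) : ℝ :=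
  sInf {C | IsRbmoOneBound μ n α β η f C}

end NonDoubling

end

/-! An admissible constant for `rbmo` is admissible for `rbmoOne`. Conversely, (b) and (c) have to
be recovered for cubes outside `ExCubes` at the cost of a constant factor.

The mechanism is a chain of dilates. Between a cube `R` and its first doubling dilate `α^m R`, `m ≥
1`, no cube is doubling. Going down this run the measure drops by more than `β` per step, while
`l^n` drops only by `α^n < β`. The terms of `K` along the run are thus dominated by a geometric
series, and replacing `R` by `α^m R` adds only a constant to `K` (`coeffK_le_add`). So for a
doubling cube of side at most 1, both the next doubling dilate (`exists_next`) and the first one of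
side greater than 1 (`exists_large`) lie in `ExCubes` and are reached at bounded cost. The former
yields (b) for `l(R) ≤ 1` by comparison through a common larger cube; the latter bounds single means
over small doubling cubes.

For (c), a large `Q` is covered by cubes `P` of side `(η - 1) / η` with centers in `Q`, so that `ηP
⊆ ηQ`. If some `α^(-k) P`, `k ≥ 1`, is doubling, the oscillation bound and a bound of the mean over
`P̃` give `∫_P |f| ≤ C A μ(ηP)`. Differentiation of measures and `β > α^d` show that almost every
center qualifies (`ae_exists_isDoubling`), and bounded overlap sums the local estimates. Given (c),
the remaining case `l(R) > 1` of (b) follows by bounding both means separately. -/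

namespace NonDoubling

/-! ### Geometry of cubes -/

namespace Cube

variable {d : ℕ}

theorem toSet_eq_closedBall {Q : Cube d} (hQ : 0 ≤ Q.side) :
    Q.toSet = Metric.closedBall Q.center (Q.side / 2) := by
  ext x
  rw [Metric.mem_closedBall, dist_pi_le_iff (by positivity)]
  rfl

theorem measurableSet_toSet {Q : Cube d} (hQ : 0 ≤ Q.side) : MeasurableSet Q.toSet := by
  rw [toSet_eq_closedBall hQ]
  exact measurableSet_closedBall

theorem isCompact_toSet {Q : Cube d} (hQ : 0 ≤ Q.side) : IsCompact Q.toSet := by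
  rw [toSet_eq_closedBall hQ]
  exact isCompact_closedBall _ _

theorem center_mem_toSet {Q : Cube d} (hQ : 0 ≤ Q.side) : Q.center ∈ Q.toSet := by
  intro i
  simp only [sub_self, abs_zero]
  positivity

@[simp] theorem scale_side (t : ℝ) (Q : Cube d) : (Q.scale t).side = t * Q.side := rfl

theorem scale_scale (s t : ℝ) (Q : Cube d) : (Q.scale t).scale s = Q.scale (s * t) := by
  simp only [scale, mul_assoc]

@[simp] theorem scale_one (Q : Cube d) : Q.scale 1 = Q := by
  simp only [scale, one_mul]

/-- A cube whose center lies in a smaller cube `Q` is contained in the cube concentric to `Q`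
with the sum of the side lengths. -/
theorem toSet_subset_of_center_mem {P Q S : Cube d} (hPQ : P.center ∈ Q.toSet)
    (hS : S.center = Q.center) (h : P.side + Q.side ≤ S.side) : P.toSet ⊆ S.toSet := by
  intro x hx i
  have h1 := hx i
  have h2 := hPQ i
  have h3 := abs_sub_le (x i) (P.center i) (Q.center i)
  rw [hS]
  linarith

theorem toSet_subset_of_center_eq {P Q : Cube d} (hPQ : P.center = Q.center)
    (h : P.side ≤ Q.side) : P.toSet ⊆ Q.toSet := by
  intro x hx i
  have h1 := hx i
  rw [← hPQ]
  linarith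

theorem toSet_subset_scale {Q : Cube d} (hQ : 0 ≤ Q.side) {t : ℝ} (ht : 1 ≤ t) :
    Q.toSet ⊆ (Q.scale t).toSet :=
  toSet_subset_of_center_eq rfl (by rw [scale_side]; nlinarith)

end Cube

/-! ### Growth against non-doubling along a chain of dilates -/

/-- The standing assumptions on the parameters and the growth of the measure. -/
structure Setting {d : ℕ} (μ : Measure (Fin d → ℝ)) (n C₀ α β : ℝ) : Prop where
  n_pos : 0 < n
  n_le : n ≤ d
  C₀_pos : 0 < C₀
  one_lt : 1 < α
  pow_lt : α ^ d < β
  growth : Growth μ C₀ n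

namespace Setting

variable {d : ℕ} {μ : Measure (Fin d → ℝ)} {n C₀ α β : ℝ}

theorem α_pos (h : Setting μ n C₀ α β) : 0 < α := one_pos.trans h.one_lt

theorem rpow_lt (h : Setting μ n C₀ α β) : α ^ n < β := by
  refine lt_of_le_of_lt ?_ h.pow_lt
  rw [← Real.rpow_natCast]
  exact Real.rpow_le_rpow_of_exponent_le h.one_lt.le h.n_le

theorem β_pos (h : Setting μ n C₀ α β) : 0 < β :=
  (Real.rpow_pos_of_pos h.α_pos n).trans h.rpow_lt

theorem one_lt_β (h : Setting μ n C₀ α β) : 1 < β :=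
  (Real.one_lt_rpow h.one_lt h.n_pos).trans h.rpow_lt

theorem rpow_logb (h : Setting μ n C₀ α β) : α ^ Real.logb α β = β :=
  Real.rpow_logb h.α_pos h.one_lt.ne' h.β_pos

theorem lt_logb (h : Setting μ n C₀ α β) : n < Real.logb α β :=
  (Real.lt_logb_iff_rpow_lt h.one_lt h.β_pos).2 h.rpow_lt

theorem measure_lt_top (h : Setting μ n C₀ α β) {Q : Cube d} (hQ : 0 < Q.side) :
    μ Q.toSet < ⊤ := (h.growth Q hQ).trans_lt ENNReal.ofReal_lt_top

theorem isLocallyFiniteMeasure (h : Setting μ n C₀ α β) : IsLocallyFiniteMeasure μ := by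
  refine ⟨fun x => ⟨Metric.closedBall x (1 / 2), Metric.closedBall_mem_nhds x (by norm_num), ?_⟩⟩
  have := h.measure_lt_top (Q := ⟨x, 1⟩) one_pos
  rwa [Cube.toSet_eq_closedBall (by exact zero_le_one)] at this

theorem real_le (h : Setting μ n C₀ α β) {Q : Cube d} (hQ : 0 < Q.side) :
    μ.real Q.toSet ≤ C₀ * Q.side ^ n :=
  ENNReal.toReal_le_of_le_ofReal
    (mul_nonneg h.C₀_pos.le (Real.rpow_nonneg hQ.le n)) (h.growth Q hQ)

theorem real_mono (h : Setting μ n C₀ α β) {Q R : Cube d} (hR : 0 < R.side)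
    (hQR : Q.toSet ⊆ R.toSet) : μ.real Q.toSet ≤ μ.real R.toSet :=
  measureReal_mono hQR (h.measure_lt_top hR).ne

theorem scale_pow_side_pos (h : Setting μ n C₀ α β) {Q : Cube d} (hQ : 0 < Q.side) (k : ℕ) :
    0 < (Q.scale (α ^ k)).side := mul_pos (pow_pos h.α_pos k) hQ

/-- Over a run of non-doubling cubes the measure grows at least geometrically. -/
theorem pow_mul_real_le (h : Setting μ n C₀ α β) {Q : Cube d} {i k : ℕ}
    (hnd : ∀ j, i ≤ j → j < i + k → ¬ IsDoubling μ α β (Q.scale (α ^ j))) :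
    β ^ k * μ.real (Q.scale (α ^ i)).toSet ≤ μ.real (Q.scale (α ^ (i + k))).toSet := by
  induction k with
  | zero => simp
  | succ k ih =>
    have h1 := ih fun j h1 h2 => hnd j h1 (by omega)
    have h2 := hnd (i + k) (by omega) (by omega)
    rw [IsDoubling, Cube.scale_scale, not_le, ← pow_succ'] at h2
    calc β ^ (k + 1) * μ.real (Q.scale (α ^ i)).toSet
        = β * (β ^ k * μ.real (Q.scale (α ^ i)).toSet) := by ring
      _ ≤ β * μ.real (Q.scale (α ^ (i + k))).toSet := by
        gcongr
        exact h.β_pos.le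
      _ ≤ _ := h2.le

/-- There are arbitrarily large doubling cubes among the dilates of a cube. -/
theorem exists_isDoubling (h : Setting μ n C₀ α β) {Q : Cube d} (hQ : 0 < Q.side) (i : ℕ) :
    ∃ j, i ≤ j ∧ IsDoubling μ α β (Q.scale (α ^ j)) := by
  by_contra! hnd
  -- Failure of doubling is a strict inequality, so the next cube has positive measure; hence the
  -- run starts at `i + 1`.
  have hpos : 0 < μ.real (Q.scale (α ^ (i + 1))).toSet := by
    have h2 := hnd i le_rfl
    rw [IsDoubling, Cube.scale_scale, not_le, ← pow_succ'] at h2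
    exact (mul_nonneg h.β_pos.le measureReal_nonneg).trans_lt h2
  have hq : 1 < β / α ^ n := (one_lt_div (Real.rpow_pos_of_pos h.α_pos n)).2 h.rpow_lt
  have hs := h.scale_pow_side_pos hQ (i + 1)
  obtain ⟨k, hk⟩ := pow_unbounded_of_one_lt
    (C₀ * (Q.scale (α ^ (i + 1))).side ^ n / μ.real (Q.scale (α ^ (i + 1))).toSet) hq
  have h1 := h.pow_mul_real_le (Q := Q) (i := i + 1) (k := k) fun j h1 _ => hnd j (by omega)
  have h2 := h.real_le (h.scale_pow_side_pos hQ (i + 1 + k))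
  rw [div_lt_iff₀ hpos, div_pow, div_mul_eq_mul_div,
    lt_div_iff₀ (pow_pos (Real.rpow_pos_of_pos h.α_pos n) k)] at hk
  have h3 : (Q.scale (α ^ (i + 1 + k))).side ^ n
      = (Q.scale (α ^ (i + 1))).side ^ n * (α ^ n) ^ k := by
    rw [← Real.rpow_natCast (α ^ n) k, ← Real.rpow_mul h.α_pos.le, mul_comm n,
      Real.rpow_mul h.α_pos.le, Real.rpow_natCast, ← Real.mul_rpow hs.le (pow_nonneg h.α_pos.le k)]
    congr 1
    simp only [Cube.scale_side]
    ring
  rw [h3, ← mul_assoc] at h2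
  linarith

/-- If the cubes `α^i R` with `1 ≤ i < m` are not doubling, the measure of the cubes concentric
with `R` decays fast below the size of `α^m R`. -/
theorem real_le_of_not_isDoubling (h : Setting μ n C₀ α β) {R : Cube d} (hR : 0 < R.side)
    {m : ℕ} (hnd : ∀ j, 1 ≤ j → j < m → ¬ IsDoubling μ α β (R.scale (α ^ j)))
    {S : Cube d} (hS : S.center = R.center) (hRS : R.side ≤ S.side) :
    μ.real S.toSet ≤
      C₀ * β * (S.side / (α ^ m * R.side)) ^ Real.logb α β * (α ^ m * R.side) ^ n := by
  have hα := h.α_pos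
  have hS0 : 0 < S.side := hR.trans_le hRS
  have hL : 0 < α ^ m * R.side := h.scale_pow_side_pos hR m
  have hγ : 0 < Real.logb α β := h.n_pos.trans h.lt_logb
  -- Above the top of the run growth suffices, since the ratio is at least 1 and `logb α β > n`.
  -- Below it, `S` is rounded up to a dilate of `R`, from which the run is climbed; the extra factor
  -- `β` pays for the rounding.
  rcases le_total (α ^ m * R.side) S.side with hle | hle
  · refine (h.real_le hS0).trans ?_
    have h1 : 1 ≤ S.side / (α ^ m * R.side) := (one_le_div hL).2 hle
    have h2 := Real.rpow_le_rpow_of_exponent_le h1 h.lt_logb.le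
    have h3 : S.side ^ n = (S.side / (α ^ m * R.side)) ^ n * (α ^ m * R.side) ^ n := by
      rw [← Real.mul_rpow (by positivity) hL.le, div_mul_cancel₀ _ hL.ne']
    rw [h3, ← mul_assoc]
    have h4 : C₀ ≤ C₀ * β := le_mul_of_one_le_right h.C₀_pos.le h.one_lt_β.le
    have h5 := h.C₀_pos
    have h6 := h.β_pos
    gcongr
  · obtain ⟨k, hk1, hk2⟩ := exists_nat_pow_near ((one_le_div hR).2 hRS) h.one_lt
    rw [le_div_iff₀ hR] at hk1
    rw [div_lt_iff₀ hR] at hk2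
    have h1 : μ.real S.toSet ≤ μ.real (R.scale (α ^ (k + 1))).toSet :=
      h.real_mono (h.scale_pow_side_pos hR _)
        (Cube.toSet_subset_of_center_eq hS hk2.le)
    have hC := h.C₀_pos
    have hβ := h.β_pos
    rcases lt_or_ge m (k + 1) with hkm | hkm
    · have h0 : α ^ m * R.side ≤ S.side := by
        refine le_trans ?_ hk1
        gcongr
        · exact h.one_lt.le
        · omega
      have h2 := h.real_le hS0
      have h3 := le_antisymm hle h0
      rw [← h3, div_self hS0.ne', Real.one_rpow, mul_one]
      refine h2.trans ?_
      gcongr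
      exact le_mul_of_one_le_right h.C₀_pos.le h.one_lt_β.le
    · obtain ⟨l, rfl⟩ := Nat.exists_eq_add_of_le hkm
      have h2 := h.pow_mul_real_le (Q := R) (i := k + 1) (k := l)
        fun j h1 h2 => hnd j (by omega) h2
      have h3 := h.real_le (h.scale_pow_side_pos hR (k + 1 + l))
      have h4 : (α ^ (l + 1))⁻¹ ≤ S.side / (α ^ (k + 1 + l) * R.side) := by
        rw [le_div_iff₀ hL]
        refine le_trans (le_of_eq ?_) hk1
        have : α ^ (k + 1 + l) = α ^ (l + 1) * α ^ k := by ring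
        rw [this]
        field_simp
      have h5 : (β ^ (l + 1))⁻¹ ≤ (S.side / (α ^ (k + 1 + l) * R.side)) ^ Real.logb α β := by
        refine le_trans (le_of_eq ?_) (Real.rpow_le_rpow (by positivity) h4 hγ.le)
        rw [Real.inv_rpow (by positivity), ← Real.rpow_natCast α, ← Real.rpow_mul hα.le,
          mul_comm ((l + 1 : ℕ) : ℝ), Real.rpow_mul hα.le, h.rpow_logb, Real.rpow_natCast]
      calc μ.real S.toSet ≤ μ.real (R.scale (α ^ (k + 1))).toSet := h1
        _ = (β ^ l)⁻¹ * (β ^ l * μ.real (R.scale (α ^ (k + 1))).toSet) := by field_simp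
        _ ≤ (β ^ l)⁻¹ * (C₀ * (α ^ (k + 1 + l) * R.side) ^ n) := by
          exact mul_le_mul_of_nonneg_left (h2.trans h3) (by positivity)
        _ = C₀ * β * (β ^ (l + 1))⁻¹ * (α ^ (k + 1 + l) * R.side) ^ n := by
          field_simp
          ring
        _ ≤ _ := by gcongr

end Setting

end NonDoubling

/-! ### The coefficients `K` -/

namespace NonDoubling

section coeff

variable {d : ℕ}

theorem coeffN_spec {Q : Cube d} (hQ : 0 < Q.side) (R : Cube d) :
    R.side ≤ 2 ^ coeffN Q R * Q.side := by
  have hne : {k : ℕ | R.side ≤ (Q.scale (2 ^ k)).side}.Nonempty := by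
    obtain ⟨k, hk⟩ := pow_unbounded_of_one_lt (R.side / Q.side) (one_lt_two (α := ℝ))
    exact ⟨k, ((div_lt_iff₀ hQ).1 hk).le⟩
  exact Nat.sInf_mem hne

theorem coeffN_le {Q R : Cube d} {k : ℕ} (h : R.side ≤ 2 ^ k * Q.side) : coeffN Q R ≤ k :=
  Nat.sInf_le h

theorem coeffN_mono {Q R S : Cube d} (hQ : 0 < Q.side) (h : R.side ≤ S.side) :
    coeffN Q R ≤ coeffN Q S :=
  coeffN_le (h.trans (coeffN_spec hQ S))

theorem coeffK_term_nonneg {μ : Measure (Fin d → ℝ)} {n : ℝ} {Q : Cube d} (hQ : 0 < Q.side)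
    (k : ℕ) : 0 ≤ μ.real (Q.scale (2 ^ k)).toSet / (Q.scale (2 ^ k)).side ^ n :=
  div_nonneg measureReal_nonneg (Real.rpow_nonneg (mul_nonneg (by positivity) hQ.le) n)

theorem coeffK_mono {μ : Measure (Fin d → ℝ)} {n : ℝ} {Q R S : Cube d} (hQ : 0 < Q.side)
    (h : R.side ≤ S.side) : coeffK μ n Q R ≤ coeffK μ n Q S :=
  add_le_add_right (Finset.sum_le_sum_of_subset_of_nonneg
    (Finset.Icc_subset_Icc_right (coeffN_mono hQ h)) fun k _ _ => coeffK_term_nonneg hQ k) 1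

theorem one_le_coeffK {μ : Measure (Fin d → ℝ)} {n : ℝ} {Q R : Cube d} (hQ : 0 < Q.side) :
    1 ≤ coeffK μ n Q R :=
  le_add_of_nonneg_right (Finset.sum_nonneg fun k _ => coeffK_term_nonneg hQ k)

end coeff

/-- The bound for the part of `coeffK` that belongs to a run of non-doubling cubes. -/
noncomputable def tailConst (n C₀ α β : ℝ) : ℝ :=
  C₀ * β * 2 ^ Real.logb α β * 2 ^ (Real.logb α β - n) *
    (1 - (2 ^ (Real.logb α β - n))⁻¹)⁻¹

namespace Setting

variable {d : ℕ} {μ : Measure (Fin d → ℝ)} {n C₀ α β : ℝ}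

theorem one_lt_two_rpow (h : Setting μ n C₀ α β) : (1 : ℝ) < 2 ^ (Real.logb α β - n) :=
  Real.one_lt_rpow one_lt_two (sub_pos.2 h.lt_logb)

theorem tailConst_pos (h : Setting μ n C₀ α β) : 0 < tailConst n C₀ α β := by
  have h1 := h.C₀_pos
  have h2 := h.β_pos
  have h3 := inv_lt_one_of_one_lt₀ h.one_lt_two_rpow
  have h4 : 0 < 1 - ((2 : ℝ) ^ (Real.logb α β - n))⁻¹ := sub_pos.2 h3
  unfold tailConst
  positivity

theorem coeffK_le_of_side_le (h : Setting μ n C₀ α β) {Q R : Cube d} (hQ : 0 < Q.side) {N : ℕ}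
    (hN : R.side ≤ 2 ^ N * Q.side) : coeffK μ n Q R ≤ 1 + N * C₀ := by
  refine add_le_add_right ?_ 1
  calc _ ≤ ∑ k ∈ Finset.Icc 1 (coeffN Q R), C₀ := by
        refine Finset.sum_le_sum fun k _ => ?_
        have hs : 0 < (Q.scale (2 ^ k)).side := mul_pos (by positivity) hQ
        rw [div_le_iff₀ (Real.rpow_pos_of_pos hs n)]
        exact h.real_le hs
    _ = coeffN Q R * C₀ := by simp
    _ ≤ _ := by
        have := h.C₀_pos
        gcongr
        exact coeffN_le hN

/-- Only the terms with `N < k ≤ M` are new. There `2^k Q` is at least as large as `R`, so the decay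
along the run applies and the terms decrease geometrically in `M - k` with ratio `2^(n - γ)`. The
cube `R` itself need not be doubling. -/
theorem coeffK_le_add (h : Setting μ n C₀ α β) {R : Cube d} (hR : 0 < R.side) {m : ℕ}
    (hnd : ∀ j, 1 ≤ j → j < m → ¬ IsDoubling μ α β (R.scale (α ^ j)))
    {Q : Cube d} (hQ : 0 < Q.side) (hc : Q.center ∈ R.toSet) :
    coeffK μ n Q (R.scale (α ^ m)) ≤ coeffK μ n Q R + tailConst n C₀ α β := by
  set N := coeffN Q R
  set M := coeffN Q (R.scale (α ^ m))
  set γ := Real.logb α β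
  set a : ℝ := 2 ^ (γ - n) with ha_def
  have ha : 1 < a := h.one_lt_two_rpow
  have hC := h.C₀_pos
  have hβ := h.β_pos
  have hγ : n < γ := h.lt_logb
  have hn := h.n_pos
  set L := α ^ m * R.side with hL_def
  have hL : 0 < L := h.scale_pow_side_pos hR m
  have hterm : ∀ k ∈ Finset.Ioc N M,
      μ.real (Q.scale (2 ^ k)).toSet / (Q.scale (2 ^ k)).side ^ n
        ≤ C₀ * β * 2 ^ γ * a * a⁻¹ ^ (M - k) := by
    intro k hk
    obtain ⟨hk1, hk2⟩ := Finset.mem_Ioc.1 hk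
    rw [Cube.scale_side]
    set x := 2 ^ k * Q.side with hx_def
    have hx : 0 < x := by positivity
    have hRx : R.side ≤ x := (coeffN_spec hQ R).trans (by rw [hx_def]; gcongr; exact one_le_two)
    -- By minimality of `M`, the cube `2^(M-1) Q` is still smaller than `α^m R`.
    have hxL : x / L ≤ 2 * (2 ^ (M - k))⁻¹ := by
      have h1 : ¬ L ≤ 2 ^ (M - 1) * Q.side := fun hle => by
        have := coeffN_le (Q := Q) (R := R.scale (α ^ m)) hle
        change M ≤ M - 1 at this
        omega
      rw [div_le_iff₀ hL, mul_assoc, mul_comm, mul_assoc, ← div_eq_inv_mul]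
      have h2 : (2 : ℝ) ^ (M - k) * x = 2 * (2 ^ (M - 1) * Q.side) := by
        rw [hx_def, ← mul_assoc, ← mul_assoc, ← pow_add, ← pow_succ']
        congr 2
        omega
      have h3 : x = (2 * (2 ^ (M - 1) * Q.side)) / 2 ^ (M - k) := by
        rw [← h2]; field_simp
      rw [h3]
      push Not at h1
      have h4 : 2 * (2 ^ (M - 1) * Q.side) ≤ L * 2 := by linarith
      calc _ ≤ L * 2 / 2 ^ (M - k) := by gcongr
        _ = _ := by ring
    -- The decay estimate needs a cube concentric with `R`; recentering doubles the side, which is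
    -- the source of `2^γ`.
    have h1 : μ.real (Q.scale (2 ^ k)).toSet ≤ μ.real (⟨R.center, 2 * x⟩ : Cube d).toSet := by
      refine h.real_mono (by positivity) (Cube.toSet_subset_of_center_mem (Q := R) hc rfl ?_)
      change x + R.side ≤ 2 * x
      linarith
    have h2 := h.real_le_of_not_isDoubling hR hnd (S := ⟨R.center, 2 * x⟩) rfl
      (by change R.side ≤ 2 * x; linarith)
    rw [div_le_iff₀ (by positivity)]
    refine (h1.trans h2).trans ?_
    change C₀ * β * (2 * x / L) ^ γ * L ^ n ≤ _
    have h3 : (2 * x / L) ^ γ * L ^ n = 2 ^ γ * (x / L) ^ (γ - n) * x ^ n := by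
      have e1 : (x / L) ^ γ = (x / L) ^ (γ - n) * (x / L) ^ n := by
        rw [← Real.rpow_add (by positivity), sub_add_cancel]
      have e2 : (x / L) ^ n * L ^ n = x ^ n := by
        rw [← Real.mul_rpow (by positivity) hL.le, div_mul_cancel₀ _ hL.ne']
      rw [mul_div_assoc, Real.mul_rpow zero_le_two (by positivity), e1, ← e2]
      ring
    have h4 : (x / L) ^ (γ - n) ≤ a * a⁻¹ ^ (M - k) := by
      refine (Real.rpow_le_rpow (by positivity) hxL (by linarith)).trans (le_of_eq ?_)
      rw [Real.mul_rpow zero_le_two (by positivity), Real.inv_rpow (by positivity),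
        ← Real.rpow_natCast 2, ← Real.rpow_mul zero_le_two, mul_comm ((M - k : ℕ) : ℝ),
        Real.rpow_mul zero_le_two, Real.rpow_natCast, inv_pow]
    rw [mul_assoc (C₀ * β), h3]
    calc C₀ * β * (2 ^ γ * (x / L) ^ (γ - n) * x ^ n)
        ≤ C₀ * β * (2 ^ γ * (a * a⁻¹ ^ (M - k)) * x ^ n) := by gcongr
      _ = _ := by ring
  have hgeom : ∑ k ∈ Finset.Ioc N M, a⁻¹ ^ (M - k) ≤ (1 - a⁻¹)⁻¹ := by
    have h0 : 0 ≤ a⁻¹ := by positivity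
    have h1 : a⁻¹ < 1 := inv_lt_one_of_one_lt₀ ha
    rw [← tsum_geometric_of_lt_one h0 h1]
    calc _ ≤ ∑ k ∈ Finset.range (M + 1), a⁻¹ ^ (M + 1 - 1 - k) := by
          refine Finset.sum_le_sum_of_subset_of_nonneg (fun k hk => ?_) fun _ _ _ => by positivity
          rw [Finset.mem_Ioc] at hk
          rw [Finset.mem_range]
          omega
      _ = ∑ k ∈ Finset.range (M + 1), a⁻¹ ^ k := Finset.sum_range_reflect (fun k => a⁻¹ ^ k) _
      _ ≤ _ := (summable_geometric_of_lt_one h0 h1).sum_le_tsum _ fun _ _ => by positivity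
  rw [coeffK, coeffK, add_assoc]
  refine add_le_add_right ?_ 1
  calc _ ≤ ∑ k ∈ Finset.Icc 1 N ∪ Finset.Ioc N M,
          μ.real (Q.scale (2 ^ k)).toSet / (Q.scale (2 ^ k)).side ^ n := by
        refine Finset.sum_le_sum_of_subset_of_nonneg (fun k hk => ?_)
          fun k _ _ => coeffK_term_nonneg hQ k
        rw [Finset.mem_Icc] at hk
        rw [Finset.mem_union, Finset.mem_Icc, Finset.mem_Ioc]
        omega
    _ = _ := Finset.sum_union (Finset.disjoint_left.2 fun k h1 h2 => by
        rw [Finset.mem_Icc] at h1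
        rw [Finset.mem_Ioc] at h2
        omega)
    _ ≤ _ := by
        refine add_le_add_right ((Finset.sum_le_sum hterm).trans ?_) _
        rw [← Finset.mul_sum]
        exact mul_le_mul_of_nonneg_left hgeom (by positivity)

end Setting

end NonDoubling

/-! ### Reaching `ExCubes`, and bounds of means -/

namespace NonDoubling

namespace Setting

variable {d : ℕ} {μ : Measure (Fin d → ℝ)} {n C₀ α β η : ℝ}

theorem scale_inv_scale (h : Setting μ n C₀ α β) (Q : Cube d) {i m : ℕ} (him : i ≤ m) :
    (Q.scale (α ^ m)).scale (α ^ i)⁻¹ = Q.scale (α ^ (m - i)) := by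
  have hα := h.α_pos
  rw [Cube.scale_scale]
  congr 1
  rw [pow_sub₀ α hα.ne' him, mul_comm]

/-- The cube `(α^m Q)'` is the last doubling one below `α^m Q`. The index `k` ensures that it occurs
among the `α^j Q` with `j < m`, where `hs` bounds its side. -/
theorem scale_mem_exCubes (h : Setting μ n C₀ α β) {Q : Cube d} (hQ : 0 < Q.side) {k m : ℕ}
    (hkm : k < m) (hk : IsDoubling μ α β (Q.scale (α ^ k)))
    (hs : ∀ j, j < m → IsDoubling μ α β (Q.scale (α ^ j)) → (Q.scale (α ^ j)).side ≤ 1) :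
    Q.scale (α ^ m) ∈ ExCubes μ α β := by
  refine ⟨h.scale_pow_side_pos hQ m, ?_⟩
  set s := {i : ℕ | 1 ≤ i ∧ IsDoubling μ α β ((Q.scale (α ^ m)).scale (α ^ i)⁻¹)}
  have hmem : m - k ∈ s := by
    refine ⟨by omega, ?_⟩
    rwa [h.scale_inv_scale Q (by omega), Nat.sub_sub_self hkm.le]
  have hle : sInf s ≤ m := (Nat.sInf_le hmem).trans (Nat.sub_le m k)
  obtain ⟨h1, h2⟩ := Nat.sInf_mem ⟨_, hmem⟩
  refine ⟨sInf s, ⟨⟨h1, h2⟩, fun i hi => Nat.sInf_le hi⟩, ?_⟩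
  rw [h.scale_inv_scale Q hle] at h2 ⊢
  exact hs _ (by omega) h2

/-- The next doubling dilate of a small doubling cube lies in the family `ExCubes`. -/
theorem exists_next (h : Setting μ n C₀ α β) {R : Cube d} (hR : R ∈ SmallCubes d)
    (hRd : IsDoubling μ α β R) :
    ∃ S ∈ ExCubes μ α β, IsDoubling μ α β S ∧ R.toSet ⊆ S.toSet ∧
      ∀ Q : Cube d, 0 < Q.side → Q.center ∈ R.toSet →
        coeffK μ n Q S ≤ coeffK μ n Q R + tailConst n C₀ α β := by
  classical
  have hex := h.exists_isDoubling hR.1 1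
  obtain ⟨h1, h2⟩ := Nat.find_spec hex
  have hnd : ∀ j, 1 ≤ j → j < Nat.find hex → ¬ IsDoubling μ α β (R.scale (α ^ j)) :=
    fun j hj1 hj2 hj3 => Nat.find_min hex hj2 ⟨hj1, hj3⟩
  refine ⟨R.scale (α ^ Nat.find hex), h.scale_mem_exCubes hR.1 (k := 0) h1 (by simpa using hRd) ?_,
    h2, Cube.toSet_subset_scale hR.1.le (one_le_pow₀ h.one_lt.le),
    fun Q hQ hc => h.coeffK_le_add hR.1 hnd hQ hc⟩
  intro j hj hjd
  rcases Nat.eq_zero_or_pos j with rfl | hj0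
  · simpa using hR.2
  · exact absurd hjd (hnd j hj0 hj)

/-- The first large doubling dilate of a small doubling cube lies in the family `ExCubes`. -/
theorem exists_large (h : Setting μ n C₀ α β) {Q : Cube d} (hQ : Q ∈ SmallCubes d)
    (hQd : IsDoubling μ α β Q) :
    ∃ S ∈ ExCubes μ α β \ SmallCubes d, IsDoubling μ α β S ∧ Q.toSet ⊆ S.toSet ∧
      ∀ R : Cube d, 1 ≤ R.side → coeffK μ n Q S ≤ coeffK μ n Q R + tailConst n C₀ α β := by
  classical
  have hα := h.α_pos
  -- `α^l Q` is the last dilate of side at most 1; it serves as the base of the non-doubling run up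
  -- to `α^m Q`.
  obtain ⟨l, hl1, hl2⟩ := exists_nat_pow_near ((one_le_div hQ.1).2 hQ.2) h.one_lt
  rw [le_div_iff₀ hQ.1] at hl1
  rw [div_lt_iff₀ hQ.1] at hl2
  have hex := h.exists_isDoubling hQ.1 (l + 1)
  obtain ⟨h1, h2⟩ := Nat.find_spec hex
  set m := Nat.find hex with hm
  have hside : 1 < (Q.scale (α ^ m)).side := by
    refine hl2.trans_le ?_
    have := hQ.1.le
    rw [Cube.scale_side]
    gcongr
    exact h.one_lt.le
  have hR := h.scale_pow_side_pos hQ.1 l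
  refine ⟨Q.scale (α ^ m), ⟨h.scale_mem_exCubes hQ.1 (k := 0) (by omega) (by simpa using hQd) ?_,
    fun hS => absurd hS.2 hside.not_ge⟩, h2,
    Cube.toSet_subset_scale hQ.1.le (one_le_pow₀ h.one_lt.le), fun R hRs => ?_⟩
  · intro j hj hjd
    have hjl : j ≤ l := by
      by_contra! hlj
      exact Nat.find_min hex hj ⟨hlj, hjd⟩
    refine le_trans ?_ hl1
    have := hQ.1.le
    rw [Cube.scale_side]
    gcongr
    exact h.one_lt.le
  · obtain ⟨i, hi⟩ := Nat.exists_eq_add_of_le (show l ≤ m by omega)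
    have hS : Q.scale (α ^ m) = (Q.scale (α ^ l)).scale (α ^ i) := by
      rw [Cube.scale_scale, ← pow_add, hi, add_comm]
    have hK := h.coeffK_le_add (R := Q.scale (α ^ l)) hR (m := i) (fun j hj1 hj2 hj3 => by
      rw [Cube.scale_scale, ← pow_add] at hj3
      exact Nat.find_min hex (m := j + l) (by omega) ⟨by omega, hj3⟩) hQ.1
      (Cube.center_mem_toSet (Q := Q.scale (α ^ l)) hR.le)
    rw [hS]
    exact hK.trans (by gcongr; exact coeffK_mono hQ.1 (hl1.trans hRs))

theorem setIntegral_le (h : Setting μ n C₀ α β) (hη : 1 < η) {Q : Cube d} (hQ : 0 < Q.side)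
    {g : (Fin d → ℝ) → ℝ} {A : ℝ} (hA : (∫ x in Q.toSet, g x ∂μ) / μ.real (Q.scale η).toSet ≤ A) :
    ∫ x in Q.toSet, g x ∂μ ≤ A * μ.real (Q.scale η).toSet := by
  have hηQ : 0 < (Q.scale η).side := mul_pos (by linarith) hQ
  -- If `μ(ηQ) = 0` the quotient is 0 by convention and `hA` carries no information, but then `Q` is
  -- null.
  rcases (measureReal_nonneg (μ := μ) (s := (Q.scale η).toSet)).eq_or_lt with h0 | h0
  · have h1 : μ Q.toSet = 0 := by
      refine measure_mono_null (Cube.toSet_subset_scale hQ.le hη.le) ?_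
      exact (measureReal_eq_zero_iff (h.measure_lt_top hηQ).ne).1 h0.symm
    rw [← h0, setIntegral_measure_zero _ h1, mul_zero]
  · exact (div_le_iff₀ h0).1 hA

/-- Since `η ≤ α`, doubling gives `μ(ηR) ≤ μ(αR) ≤ β μ(R)`, which trades the normalization by
`μ(ηR)` for one by `μ(R)`. -/
theorem abs_mean_le (h : Setting μ n C₀ α β) (hη : 1 < η) (hηα : η ≤ α) {R : Cube d}
    (hR : 0 < R.side) (hRd : IsDoubling μ α β R) (hμR : 0 < μ.real R.toSet)
    {f : (Fin d → ℝ) → ℝ} {A : ℝ} (hA0 : 0 ≤ A)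
    (hA : (∫ x in R.toSet, |f x| ∂μ) / μ.real (R.scale η).toSet ≤ A) :
    |mean μ f R| ≤ A * β := by
  rw [mean, abs_div, abs_of_pos hμR, div_le_iff₀ hμR]
  calc |∫ x in R.toSet, f x ∂μ| ≤ ∫ x in R.toSet, |f x| ∂μ := abs_integral_le_integral_abs
    _ ≤ A * μ.real (R.scale η).toSet := h.setIntegral_le hη hR hA
    _ ≤ A * μ.real (R.scale α).toSet := by
      refine mul_le_mul_of_nonneg_left (h.real_mono (R := R.scale α) (mul_pos h.α_pos hR)
        (Cube.toSet_subset_of_center_eq rfl ?_)) hA0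
      simp only [Cube.scale_side]
      gcongr
    _ ≤ A * (β * μ.real R.toSet) := by
      gcongr
      exact hRd
    _ = _ := by ring

/-- The mean over `Q` is compared with that over its first doubling dilate of side greater than 1,
to which the large-cube condition applies. -/
theorem abs_mean_le_of_small (h : Setting μ n C₀ α β) (hη : 1 < η) (hηα : η ≤ α)
    {f : (Fin d → ℝ) → ℝ} {A : ℝ} (hf : IsRbmoOneBound μ n α β η f A) {Q R : Cube d}
    (hQ : Q ∈ SmallCubes d) (hQd : IsDoubling μ α β Q) (hμQ : 0 < μ.real Q.toSet)
    (hR : 1 ≤ R.side) :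
    |mean μ f Q| ≤ A * (β + tailConst n C₀ α β + coeffK μ n Q R) := by
  obtain ⟨S, hS, hSd, hQS, hK⟩ := h.exists_large hQ hQd
  have h1 := hf.means Q hQ S hS.1 hQS hQd hSd hμQ
  have h2 := h.abs_mean_le hη hηα hS.1.1 hSd (hμQ.trans_le (h.real_mono hS.1.1 hQS)) hf.nonneg
    (hf.large S hS)
  have h3 := mul_le_mul_of_nonneg_left (hK R hR) hf.nonneg
  have h4 := abs_sub_abs_le_abs_sub (mean μ f Q) (mean μ f S)
  linarith

theorem isDoubling_tilde (h : Setting μ n C₀ α β) {Q : Cube d} (hQ : 0 < Q.side) :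
    IsDoubling μ α β (tilde μ α β Q) := by
  obtain ⟨j, _, hj⟩ := h.exists_isDoubling hQ 0
  exact Nat.sInf_mem (s := {m : ℕ | IsDoubling μ α β (Q.scale (α ^ m))}) ⟨j, hj⟩

/-- The mean over `Q̃` is controlled when `Q` is small, but not too small, and has a doubling
cube below it. -/
theorem abs_mean_tilde_le (h : Setting μ n C₀ α β) (hη : 1 < η) (hηα : η ≤ α)
    {f : (Fin d → ℝ) → ℝ} {A : ℝ} (hf : IsRbmoOneBound μ n α β η f A) {N : ℕ} {Q : Cube d}
    (hQ : Q ∈ SmallCubes d) (hμQ : 0 < μ.real Q.toSet) (hN : 1 ≤ 2 ^ N * Q.side)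
    (hd : ∃ k, 1 ≤ k ∧ IsDoubling μ α β (Q.scale (α ^ k)⁻¹)) :
    |mean μ f (tilde μ α β Q)| ≤ A * (β + tailConst n C₀ α β + (1 + N * C₀)) := by
  have hα := h.α_pos
  have hC := h.C₀_pos
  have hT := h.tailConst_pos
  have htd := h.isDoubling_tilde hQ.1
  have hnd : ∀ j, j < sInf {m : ℕ | IsDoubling μ α β (Q.scale (α ^ m))} →
    ¬ IsDoubling μ α β (Q.scale (α ^ j)) := fun j hj => Nat.notMem_of_lt_sInf hj
  unfold tilde at htd ⊢
  set m := sInf {m : ℕ | IsDoubling μ α β (Q.scale (α ^ m))}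
  have hside := h.scale_pow_side_pos hQ.1 m
  have hsub : Q.toSet ⊆ (Q.scale (α ^ m)).toSet :=
    Cube.toSet_subset_scale hQ.1.le (one_le_pow₀ h.one_lt.le)
  have hμt := hμQ.trans_le (h.real_mono hside hsub)
  rcases le_or_gt (Q.scale (α ^ m)).side 1 with hle | hlt
  · have h1 := h.abs_mean_le_of_small hη hηα hf (R := ⟨0, 1⟩) ⟨hside, hle⟩ htd hμt le_rfl
    refine h1.trans (mul_le_mul_of_nonneg_left ?_ hf.nonneg)
    gcongr
    refine h.coeffK_le_of_side_le hside (hN.trans ?_)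
    gcongr
    rw [Cube.scale_side]
    exact le_mul_of_one_le_left hQ.1.le (one_le_pow₀ h.one_lt.le)
  -- Now `Q̃` has side greater than 1. Between `Q` and `Q̃` nothing is doubling, so the last
  -- doubling cube below `Q̃` in the chain from `P` is smaller than `Q`. Hence `Q̃` lies in
  -- `ExCubes`.
  · obtain ⟨k, hk1, hk2⟩ := hd
    have hm0 : m ≠ 0 := by
      intro hm
      rw [hm, pow_zero, Cube.scale_one] at hlt
      exact hlt.not_ge hQ.2
    set P := Q.scale (α ^ k)⁻¹
    have hP : 0 < P.side := mul_pos (by positivity) hQ.1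
    have hPQ : ∀ j, P.scale (α ^ (k + j)) = Q.scale (α ^ j) := fun j => by
      rw [Cube.scale_scale]
      congr 1
      rw [pow_add]
      field_simp
    have hmem : Q.scale (α ^ m) ∈ ExCubes μ α β := by
      rw [← hPQ]
      refine h.scale_mem_exCubes hP (k := 0) (by omega) (by simpa using hk2) fun j hj hjd => ?_
      rcases le_or_gt k j with hkj | hkj
      · obtain ⟨i, rfl⟩ := Nat.exists_eq_add_of_le hkj
        rw [hPQ] at hjd
        exact absurd hjd (hnd i (by omega))
      · refine le_trans ?_ hQ.2
        have h1 : Q.side = α ^ k * P.side := by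
          have := congrArg Cube.side (hPQ 0)
          simpa using this.symm
        rw [h1, Cube.scale_side]
        gcongr
        exact h.one_lt.le
    have h1 := h.abs_mean_le hη hηα hside htd hμt hf.nonneg
      (hf.large _ ⟨hmem, fun hS => hlt.not_ge hS.2⟩)
    refine h1.trans (mul_le_mul_of_nonneg_left ?_ hf.nonneg)
    have : 0 ≤ N * C₀ := by positivity
    linarith

/-- Split `|f| ≤ |f - c| + |c|` with `c` the mean over `Q̃`. This is the local form of (c) that the
covering argument sums up. -/
theorem setIntegral_abs_le (h : Setting μ n C₀ α β) (hη : 1 < η) (hηα : η ≤ α)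
    {f : (Fin d → ℝ) → ℝ} (hfi : LocallyIntegrable f μ) {A : ℝ}
    (hf : IsRbmoOneBound μ n α β η f A) {N : ℕ} {Q : Cube d}
    (hQ : Q ∈ SmallCubes d) (hN : 1 ≤ 2 ^ N * Q.side)
    (hd : ∃ k, 1 ≤ k ∧ IsDoubling μ α β (Q.scale (α ^ k)⁻¹)) :
    ∫ x in Q.toSet, |f x| ∂μ ≤
      A * (2 + β + tailConst n C₀ α β + N * C₀) * μ.real (Q.scale η).toSet := by
  have hβ := h.β_pos
  have hC := h.C₀_pos
  have hT := h.tailConst_pos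
  have hA := hf.nonneg
  rcases (measureReal_nonneg (μ := μ) (s := Q.toSet)).eq_or_lt with h0 | h0
  · rw [setIntegral_measure_zero _
      ((measureReal_eq_zero_iff (h.measure_lt_top hQ.1).ne).1 h0.symm)]
    positivity
  have h1 := h.setIntegral_le hη hQ.1 (hf.oscillation Q hQ)
  have h2 := h.abs_mean_tilde_le hη hηα hf hQ h0 hN hd
  set c := mean μ f (tilde μ α β Q)
  have hint : IntegrableOn f Q.toSet μ :=
    hfi.integrableOn_isCompact (Cube.isCompact_toSet hQ.1.le)
  have hconst : IntegrableOn (fun _ => c) Q.toSet μ :=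
    integrableOn_const (h.measure_lt_top hQ.1).ne
  have hdiff : IntegrableOn (fun x => f x - c) Q.toSet μ := hint.sub hconst
  have hηQ : 0 < (Q.scale η).side := mul_pos (by linarith) hQ.1
  calc ∫ x in Q.toSet, |f x| ∂μ ≤ ∫ x in Q.toSet, (|f x - c| + |c|) ∂μ := by
        refine integral_mono hint.abs (hdiff.abs.add hconst.abs) fun x => ?_
        have := abs_add_le (f x - c) c
        simpa using this
    _ = (∫ x in Q.toSet, |f x - c| ∂μ) + |c| * μ.real Q.toSet := by
        rw [integral_add hdiff.abs hconst.abs, setIntegral_const, smul_eq_mul,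
          mul_comm]
    _ ≤ A * μ.real (Q.scale η).toSet
        + A * (β + tailConst n C₀ α β + (1 + N * C₀)) * μ.real (Q.scale η).toSet := by
        refine add_le_add h1 (mul_le_mul h2 ?_ measureReal_nonneg (by positivity))
        exact h.real_mono hηQ (Cube.toSet_subset_scale hQ.1.le hη.le)
    _ = _ := by ring

end Setting

end NonDoubling

/-! ### Covering argument and large cubes -/

namespace NonDoubling

/-- A local inequality between two measures at a fixed scale, valid for balls with center in a
set of full measure, implies a global one with a constant given by the overlap of the balls. -/
theorem measure_le_of_ae_closedBall {d : ℕ} {μ ν : Measure (Fin d → ℝ)} (hν : ν ≪ μ)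
    {G : Set (Fin d → ℝ)} (hG : ∀ᵐ x ∂μ, x ∈ G) {r ρ : ℝ} (hr : 0 < r) {D : ENNReal}
    (hD : ∀ x ∈ G, ν (Metric.closedBall x r) ≤ D * μ (Metric.closedBall x ρ))
    {S T : Set (Fin d → ℝ)} (hT : ∀ x ∈ S, Metric.closedBall x ρ ⊆ T) :
    ν S ≤ D * ((2 * (⌈ρ / r⌉₊ + 1) + 1 : ℕ) ^ d * μ T) := by
  set L := ⌈ρ / r⌉₊ + 1 with hL
  let cell : (Fin d → ℤ) → Set (Fin d → ℝ) := fun z => {x | ∀ i, ⌊x i / r⌋ = z i}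
  have hU : ∀ z, ∃ U : Set (Fin d → ℝ), MeasurableSet U ∧ U ⊆ T ∧ ν (S ∩ cell z) ≤ D * μ U ∧
      ∀ y ∈ U, ∀ i, |⌊y i / r⌋ - z i| ≤ L := by
    intro z
    -- A `μ`-null piece is also `ν`-null and needs no ball. Any other piece contains a point of `G`,
    -- whose ball of radius `r` covers the piece, as the cells have side `r`.
    by_cases h0 : μ (S ∩ cell z) = 0
    · exact ⟨∅, MeasurableSet.empty, Set.empty_subset _, by rw [hν h0]; exact zero_le, by simp⟩
    obtain ⟨x, ⟨hxS, hxz⟩, hxG⟩ : ∃ x ∈ S ∩ cell z, x ∈ G := by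
      by_contra! hne
      exact h0 (measure_mono_null hne hG)
    refine ⟨Metric.closedBall x ρ, measurableSet_closedBall, hT x hxS,
      (measure_mono fun y hy => ?_).trans (hD x hxG), fun y hy i => ?_⟩
    · rw [Metric.mem_closedBall, dist_pi_le_iff hr.le]
      intro i
      have h1 := Int.abs_sub_lt_one_of_floor_eq_floor ((hy.2 i).trans (hxz i).symm)
      rw [← sub_div, abs_div, abs_of_pos hr, div_lt_one hr] at h1
      exact h1.le
    · have h1 : |y i - x i| ≤ ρ := (dist_le_pi_dist y x i).trans hy
      have h2 : |y i / r - x i / r| ≤ ⌈ρ / r⌉₊ := by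
        rw [← sub_div, abs_div, abs_of_pos hr]
        exact le_trans (by gcongr) (Nat.le_ceil _)
      have h3 := abs_le.1 h2
      have h4 := Int.floor_le (y i / r)
      have h5 := Int.lt_floor_add_one (y i / r)
      have h6 := Int.floor_le (x i / r)
      have h7 := Int.lt_floor_add_one (x i / r)
      rw [← hxz i, abs_le, hL]
      push_cast
      constructor
      · have : (⌊x i / r⌋ : ℝ) < (⌊y i / r⌋ + 1 + ⌈ρ / r⌉₊ : ℤ) := by
          push_cast
          linarith [h3.1]
        have := Int.cast_lt.1 this
        omega
      · have : (⌊y i / r⌋ : ℝ) < (⌊x i / r⌋ + 1 + ⌈ρ / r⌉₊ : ℤ) := by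
          push_cast
          linarith [h3.2]
        have := Int.cast_lt.1 this
        omega
  choose U hUm hUT hUν hUz using hU
  -- A point `y` lies in `U z` only if `z` is within `L` of the cell of `y` in each coordinate, so
  -- in at most `(2L + 1)^d` of these sets.
  have hoverlap : ∑' z, μ (U z) ≤ (2 * L + 1 : ℕ) ^ d * μ T := by
    calc ∑' z, μ (U z) = ∑' z, ∫⁻ y, (U z).indicator 1 y ∂μ := by
          simp_rw [lintegral_indicator_one (hUm _)]
      _ = ∫⁻ y, ∑' z, (U z).indicator 1 y ∂μ :=
          (lintegral_tsum fun z => (measurable_one.indicator (hUm z)).aemeasurable).symm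
      _ ≤ ∫⁻ y, (⋃ z, U z).indicator (fun _ => ((2 * L + 1 : ℕ) : ENNReal) ^ d) y ∂μ := by
          refine lintegral_mono fun y => ?_
          by_cases hy : y ∈ ⋃ z, U z
          · rw [Set.indicator_of_mem hy]
            rw [tsum_eq_sum (s := Fintype.piFinset fun i =>
              Finset.Icc (⌊y i / r⌋ - (L : ℤ)) (⌊y i / r⌋ + L)) fun z hz => ?_]
            · refine (Finset.sum_le_card_nsmul _ _ 1 fun z _ =>
                Set.indicator_le_self' (fun _ _ => zero_le) y).trans (le_of_eq ?_)
              rw [Fintype.card_piFinset]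
              have hcard : ∀ i, (Finset.Icc (⌊y i / r⌋ - (L : ℤ)) (⌊y i / r⌋ + L)).card
                  = 2 * L + 1 := fun i => by
                rw [Int.card_Icc]
                omega
              simp [hcard]
            · refine Set.indicator_of_notMem (fun hyz => hz ?_) _
              rw [Fintype.mem_piFinset]
              intro i
              have := abs_le.1 (hUz z y hyz i)
              rw [Finset.mem_Icc]
              omega
          · rw [Set.indicator_of_notMem hy, ENNReal.tsum_eq_zero.2 fun z =>
              Set.indicator_of_notMem (fun hz => hy (Set.mem_iUnion_of_mem z hz)) _]
      _ = (2 * L + 1 : ℕ) ^ d * μ (⋃ z, U z) :=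
          lintegral_indicator_const (MeasurableSet.iUnion hUm) _
      _ ≤ _ := by
          gcongr
          exact Set.iUnion_subset hUT
  calc ν S ≤ ν (⋃ z, S ∩ cell z) := by
        refine measure_mono fun x hx => Set.mem_iUnion.2 ⟨fun i => ⌊x i / r⌋, hx, fun i => rfl⟩
    _ ≤ ∑' z, ν (S ∩ cell z) := measure_iUnion_le _
    _ ≤ ∑' z, D * μ (U z) := ENNReal.tsum_le_tsum hUν
    _ = D * ∑' z, μ (U z) := ENNReal.tsum_mul_left
    _ ≤ _ := by gcongr

namespace Setting

variable {d : ℕ} {μ : Measure (Fin d → ℝ)} {n C₀ α β η : ℝ}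

/-- Almost every point is the center of arbitrarily small doubling cubes. -/
theorem ae_exists_isDoubling (h : Setting μ n C₀ α β) :
    ∀ᵐ x ∂μ, ∀ Q : Cube d, Q.center = x → 0 < Q.side →
      ∃ k, 1 ≤ k ∧ IsDoubling μ α β (Q.scale (α ^ k)⁻¹) := by
  have := h.isLocallyFiniteMeasure
  have hα := h.α_pos
  have hβ := h.β_pos
  -- Almost everywhere volume over `μ` on shrinking balls has a finite limit. With no doubling cube
  -- below `Q`, this ratio is at least a constant times `(β / α^d)^k` on `α^(-k) Q`, hence
  -- unbounded.
  filter_upwards [Besicovitch.ae_tendsto_rnDeriv volume μ, Measure.rnDeriv_lt_top volume μ]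
    with x hx hfin Q hQx hQ
  by_contra! hnd
  set P : ℕ → Cube d := fun k => Q.scale (α ^ k)⁻¹
  have hP : ∀ k, 0 < (P k).side := fun k => mul_pos (by positivity) hQ
  have hstep : ∀ k, β * μ.real (P (k + 1)).toSet < μ.real (P k).toSet := by
    intro k
    have h1 := hnd (k + 1) (by omega)
    rw [IsDoubling, not_le, Cube.scale_scale] at h1
    have h2 : α * (α ^ (k + 1))⁻¹ = (α ^ k)⁻¹ := by
      rw [pow_succ]
      field_simp
    rwa [h2] at h1
  have hpos : ∀ k, 0 < μ.real (P k).toSet := fun k =>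
    (mul_nonneg hβ.le measureReal_nonneg).trans_lt (hstep k)
  have hdecay : ∀ k, β ^ k * μ.real (P k).toSet ≤ μ.real (P 0).toSet := by
    intro k
    induction k with
    | zero => simp
    | succ k ih =>
      refine le_trans ?_ ih
      rw [pow_succ, mul_assoc]
      exact mul_le_mul_of_nonneg_left (hstep k).le (by positivity)
  have hlim : Filter.Tendsto (fun k => (P k).side / 2) Filter.atTop (nhdsWithin 0 (Set.Ioi 0)) := by
    refine tendsto_nhdsWithin_iff.2 ⟨?_, Filter.Eventually.of_forall fun k => half_pos (hP k)⟩
    have h1 := (tendsto_pow_atTop_nhds_zero_of_lt_one (inv_nonneg.2 hα.le)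
      (inv_lt_one_of_one_lt₀ h.one_lt)).mul_const (Q.side / 2)
    rw [zero_mul] at h1
    refine h1.congr fun k => ?_
    simp only [P, Cube.scale_side, inv_pow]
    ring
  have h1 := hx.comp hlim
  have h2 : Filter.Tendsto (fun k : ℕ => ENNReal.ofReal
      ((β / α ^ d) ^ k * (Q.side ^ d / μ.real (P 0).toSet))) Filter.atTop (nhds ⊤) := by
    refine ENNReal.tendsto_ofReal_atTop.comp
      ((tendsto_pow_atTop_atTop_of_one_lt ?_).atTop_mul_const (div_pos (pow_pos hQ d) (hpos 0)))
    exact (one_lt_div (pow_pos hα d)).2 h.pow_lt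
  refine hfin.ne (tendsto_nhds_unique h1 (tendsto_nhds_top_mono' h2 fun k => ?_))
  have hball : Metric.closedBall x ((P k).side / 2) = (P k).toSet := by
    rw [Cube.toSet_eq_closedBall (hP k).le, ← hQx]
    rfl
  simp only [Function.comp_apply]
  rw [Real.volume_pi_closedBall x (half_pos (hP k)).le, hball,
    ← ofReal_measureReal (h.measure_lt_top (hP k)).ne, ← ENNReal.ofReal_div_of_pos (hpos k),
    mul_div_cancel₀ _ (two_ne_zero' ℝ), Fintype.card_fin]
  refine ENNReal.ofReal_le_ofReal ?_
  have hside : (P k).side ^ d = ((α ^ d) ^ k)⁻¹ * Q.side ^ d := by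
    simp only [P, Cube.scale_side, mul_pow, inv_pow]
    rw [← pow_mul, ← pow_mul, mul_comm d k, mul_comm]
  rw [hside, div_pow, le_div_iff₀ (hpos k)]
  have h3 := hdecay k
  have h4 := hpos 0
  calc _ = ((α ^ d) ^ k)⁻¹ * Q.side ^ d * ((β ^ k * μ.real (P k).toSet) / μ.real (P 0).toSet) := by
        field_simp
    _ ≤ ((α ^ d) ^ k)⁻¹ * Q.side ^ d * 1 := by
        gcongr
        exact (div_le_one h4).2 h3
    _ = _ := mul_one _

/-- The bound of `∫_Q |f|` for all large cubes, from the bounds of `IsRbmoOneBound`. -/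
theorem setIntegral_abs_le_of_large (h : Setting μ n C₀ α β) (hη : 1 < η) (hηα : η ≤ α)
    {f : (Fin d → ℝ) → ℝ} (hfi : LocallyIntegrable f μ) {A : ℝ}
    (hf : IsRbmoOneBound μ n α β η f A) {N : ℕ} (hN : 1 ≤ 2 ^ N * ((η - 1) / η))
    {Q : Cube d} (hQ : 1 < Q.side) :
    ∫ x in Q.toSet, |f x| ∂μ ≤
      A * ((2 + β + tailConst n C₀ α β + N * C₀) * (2 * (⌈η⌉₊ + 1) + 1 : ℕ) ^ d) *
        μ.real (Q.scale η).toSet := by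
  have hη0 : 0 < η := one_pos.trans hη
  have hβ := h.β_pos
  have hC := h.C₀_pos
  have hT := h.tailConst_pos
  have hA := hf.nonneg
  -- With this side, `η c + l(Q) = η - 1 + l(Q) ≤ η l(Q)` because `l(Q) > 1`; so `ηP ⊆ ηQ` for
  -- centers in `Q`.
  set c := (η - 1) / η with hc
  have hc0 : 0 < c := div_pos (by linarith) hη0
  have hc1 : c ≤ 1 := (div_le_one hη0).2 (by linarith)
  have hηc : η * c = η - 1 := mul_div_cancel₀ _ hη0.ne'
  have hQ0 : 0 < Q.side := one_pos.trans hQ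
  have hηQ : 0 < (Q.scale η).side := mul_pos hη0 hQ0
  have hdens : ∀ P : Cube d, 0 < P.side → μ.withDensity (fun x => ‖f x‖ₑ) P.toSet
      = ENNReal.ofReal (∫ x in P.toSet, |f x| ∂μ) := fun P hP => by
    rw [withDensity_apply _ (Cube.measurableSet_toSet hP.le)]
    exact (ofReal_integral_norm_eq_lintegral_enorm
      (hfi.integrableOn_isCompact (Cube.isCompact_toSet hP.le))).symm
  set B := 2 + β + tailConst n C₀ α β + N * C₀ with hB_def
  have hB : 0 < B := by positivity
  have key := measure_le_of_ae_closedBall (withDensity_absolutelyContinuous μ fun x => ‖f x‖ₑ)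
    h.ae_exists_isDoubling (half_pos hc0) (ρ := η * c / 2) (D := ENNReal.ofReal (A * B))
    (S := Q.toSet) (T := (Q.scale η).toSet) (fun x hx => ?_) (fun x hx => ?_)
  · rw [hdens Q hQ0, ← ofReal_measureReal (h.measure_lt_top hηQ).ne,
      div_div_div_cancel_right₀ two_ne_zero, mul_div_cancel_right₀ _ hc0.ne',
      ← ENNReal.ofReal_natCast, ← ENNReal.ofReal_pow (by positivity),
      ← ENNReal.ofReal_mul (by positivity), ← ENNReal.ofReal_mul (by positivity)] at key
    refine ((ENNReal.ofReal_le_ofReal_iff (by positivity)).1 key).trans (le_of_eq ?_)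
    ring
  · have hP : (⟨x, c⟩ : Cube d) ∈ SmallCubes d := ⟨hc0, hc1⟩
    have h1 := h.setIntegral_abs_le hη hηα hfi hf hP hN (hx _ rfl hc0)
    have hηP : 0 < (Cube.scale η ⟨x, c⟩ : Cube d).side := mul_pos hη0 hc0
    have e1 := Cube.toSet_eq_closedBall (Q := ⟨x, c⟩) hc0.le
    have e2 := Cube.toSet_eq_closedBall hηP.le
    change _ = Metric.closedBall x (c / 2) at e1
    change _ = Metric.closedBall x (η * c / 2) at e2
    rw [← e1, ← e2, hdens _ hc0, ← ofReal_measureReal (h.measure_lt_top hηP).ne,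
      ← ENNReal.ofReal_mul (by positivity)]
    exact ENNReal.ofReal_le_ofReal h1
  · have hηP : 0 < (Cube.scale η ⟨x, c⟩ : Cube d).side := mul_pos hη0 hc0
    have e2 := Cube.toSet_eq_closedBall hηP.le
    change _ = Metric.closedBall x (η * c / 2) at e2
    rw [← e2]
    refine Cube.toSet_subset_of_center_mem (Q := Q) hx rfl ?_
    simp only [Cube.scale_side]
    nlinarith

end Setting

end NonDoubling

/-! ### Comparison of the admissible constants and of the norms -/

namespace NonDoubling

theorem IsRbmoBound.isRbmoOneBound {d : ℕ} {μ : Measure (Fin d → ℝ)} {n α β η : ℝ}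
    {f : (Fin d → ℝ) → ℝ} {A : ℝ} (hf : IsRbmoBound μ n α β η f A) :
    IsRbmoOneBound μ n α β η f A where
  nonneg := hf.nonneg
  oscillation Q hQ := hf.oscillation Q hQ.1 hQ.2
  means Q hQ R hR hQR hQd hRd hμ := hf.means Q R hQ.1 hR.1 hQR hQd hRd hμ hQ.2
  large Q hQ := hf.large Q (not_le.1 fun hle => hQ.2 ⟨hQ.1.1, hle⟩)

theorem IsRbmoOneBound.isRbmoBound {d : ℕ} {μ : Measure (Fin d → ℝ)} {n C₀ α β η : ℝ}
    (h : Setting μ n C₀ α β) (hη : 1 < η) (hηα : η ≤ α) {N : ℕ}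
    (hN : 1 ≤ 2 ^ N * ((η - 1) / η)) {Λ : ℝ}
    (hΛ : Λ = (2 + β + tailConst n C₀ α β + N * C₀) * (2 * (⌈η⌉₊ + 1) + 1 : ℕ) ^ d)
    {f : (Fin d → ℝ) → ℝ} (hfi : LocallyIntegrable f μ) {A : ℝ}
    (hf : IsRbmoOneBound μ n α β η f A) :
    IsRbmoBound μ n α β η f ((2 + 2 * tailConst n C₀ α β + β + Λ + Λ * β) * A) := by
  have hβ := h.β_pos
  have hC := h.C₀_pos
  have hT := h.tailConst_pos
  have hA := hf.nonneg
  have hΛ0 : 0 ≤ Λ := by rw [hΛ]; positivity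
  have hΛβ : 0 ≤ Λ * β := by positivity
  have hlarge : ∀ Q : Cube d, 1 < Q.side →
      (∫ x in Q.toSet, |f x| ∂μ) / μ.real (Q.scale η).toSet ≤ A * Λ := fun Q hQ => by
    refine div_le_of_le_mul₀ measureReal_nonneg (by positivity) ?_
    rw [hΛ]
    exact h.setIntegral_abs_le_of_large hη hηα hfi hf hN hQ
  set T := tailConst n C₀ α β
  refine ⟨by positivity, fun Q hQ hQ1 => ?_, fun Q R hQ hR hQR hQd hRd hμQ hQ1 => ?_,
    fun Q hQ => ?_⟩
  · refine (hf.oscillation Q ⟨hQ, hQ1⟩).trans (le_mul_of_one_le_left hA ?_)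
    linarith
  · have hK : 1 ≤ coeffK μ n Q R := one_le_coeffK hQ
    have hμR := hμQ.trans_le (h.real_mono hR hQR)
    have hbound : ∀ x, x ≤ (2 + 2 * T + β + Λ + Λ * β) * coeffK μ n Q R →
        A * x ≤ (2 + 2 * T + β + Λ + Λ * β) * A * coeffK μ n Q R := fun x hx => by
      calc A * x ≤ A * ((2 + 2 * T + β + Λ + Λ * β) * coeffK μ n Q R) := by gcongr
        _ = _ := by ring
    have hTK := le_mul_of_one_le_right hT.le hK
    have hβK := le_mul_of_one_le_right hβ.le hK
    have hΛK := le_mul_of_one_le_right hΛ0 hK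
    have hΛβK := le_mul_of_one_le_right hΛβ hK
    -- A large `R` need not be in `ExCubes`, so both means are bounded separately; for small `R`
    -- they are compared through the next doubling dilate `S` of `R`.
    rcases lt_or_ge 1 R.side with hR1 | hR1
    · have h1 := h.abs_mean_le_of_small hη hηα hf ⟨hQ, hQ1⟩ hQd hμQ hR1.le
      have h2 := h.abs_mean_le hη hηα hR hRd hμR (by positivity) (hlarge R hR1)
      have h3 := abs_sub (mean μ f Q) (mean μ f R)
      refine le_trans ?_ (hbound (β + T + coeffK μ n Q R + Λ * β) (by linarith))
      linarith
    · obtain ⟨S, hS, hSd, hRS, hKS⟩ := h.exists_next ⟨hR, hR1⟩ hRd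
      have h1 := hf.means Q ⟨hQ, hQ1⟩ S hS (hQR.trans hRS) hQd hSd hμQ
      have h2 := hf.means R ⟨hR, hR1⟩ S hS hRS hRd hSd hμR
      have h3 := mul_le_mul_of_nonneg_left
        (hKS Q hQ (hQR (Cube.center_mem_toSet hQ.le))) hA
      have h4 := mul_le_mul_of_nonneg_left (hKS R hR (Cube.center_mem_toSet hR.le)) hA
      have h5 := mul_le_mul_of_nonneg_left
        (h.coeffK_le_of_side_le (Q := R) (R := R) (N := 0) hR (by simp)) hA
      have h6 := abs_sub_le (mean μ f Q) (mean μ f S) (mean μ f R)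
      rw [abs_sub_comm (mean μ f S)] at h6
      refine le_trans ?_ (hbound (coeffK μ n Q R + T + (1 + T)) (by linarith))
      push_cast at h5
      linarith
  · refine (hlarge Q hQ).trans ?_
    rw [mul_comm]
    gcongr
    linarith

end NonDoubling

theorem theorem3p1 (d : ℕ) (n C₀ α β η : ℝ) (hn : 0 < n) (hnd : n ≤ d) (hC₀ : 0 < C₀)
    (hη : 1 < η) (hηα : η ≤ α) (hβ : α ^ d < β) :
    ∃ C : ℝ, 0 < C ∧ ∀ μ : MeasureTheory.Measure (Fin d → ℝ), NonDoubling.Growth μ C₀ n →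
      NonDoubling.rbmoOne μ n α β η = NonDoubling.rbmo μ n α β η ∧
      ∀ f ∈ NonDoubling.rbmo μ n α β η,
        NonDoubling.rbmoOneNorm μ n α β η f ≤ C * NonDoubling.rbmoNorm μ n α β η f ∧
        NonDoubling.rbmoNorm μ n α β η f ≤ C * NonDoubling.rbmoOneNorm μ n α β η f := by
  obtain ⟨N, hN⟩ : ∃ N : ℕ, 1 ≤ 2 ^ N * ((η - 1) / η) := by
    have hc : 0 < (η - 1) / η := div_pos (by linarith) (by linarith)
    obtain ⟨N, hN⟩ := pow_unbounded_of_one_lt ((η - 1) / η)⁻¹ (one_lt_two (α := ℝ))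
    exact ⟨N, ((inv_lt_iff_one_lt_mul₀ hc).1 hN).le⟩
  have hα : 1 < α := hη.trans_le hηα
  have hβ0 : 0 < β := (pow_pos (one_pos.trans hα) d).trans hβ
  -- `C` must be fixed before `μ`; the zero measure serves as an instance of the setting, since the
  -- constant does not involve the measure.
  have hT : 0 < NonDoubling.tailConst n C₀ α β :=
    NonDoubling.Setting.tailConst_pos (d := d) (μ := 0)
      ⟨hn, hnd, hC₀, hα, hβ, fun _ _ => by simp⟩
  obtain ⟨Λ, hΛ⟩ : ∃ Λ, Λ = (2 + β + NonDoubling.tailConst n C₀ α β + N * C₀) *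
    (2 * (⌈η⌉₊ + 1) + 1 : ℕ) ^ d := ⟨_, rfl⟩
  have hΛ0 : 0 < Λ := by rw [hΛ]; positivity
  set C := 2 + 2 * NonDoubling.tailConst n C₀ α β + β + Λ + Λ * β with hC
  have hC1 : 1 ≤ C := by
    have := mul_pos hΛ0 hβ0
    linarith
  refine ⟨C, by linarith, fun μ hμ => ?_⟩
  have h : NonDoubling.Setting μ n C₀ α β := ⟨hn, hnd, hC₀, hα, hβ, hμ⟩
  refine ⟨Set.Subset.antisymm ?_ ?_, ?_⟩
  · rintro f ⟨hfi, A, hA⟩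
    exact ⟨hfi, _, hA.isRbmoBound h hη hηα hN hΛ hfi⟩
  · rintro f ⟨hfi, A, hA⟩
    exact ⟨hfi, A, hA.isRbmoOneBound⟩
  · rintro f ⟨hfi, A, hA⟩
    have hbdd : BddBelow {A | NonDoubling.IsRbmoBound μ n α β η f A} :=
      ⟨0, fun _ hA => hA.nonneg⟩
    have hbddOne : BddBelow {A | NonDoubling.IsRbmoOneBound μ n α β η f A} :=
      ⟨0, fun _ hA => hA.nonneg⟩
    constructor
    · refine (csInf_le_csInf hbddOne ⟨A, hA⟩ fun A hA => hA.isRbmoOneBound).trans ?_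
      exact le_mul_of_one_le_left (Real.sInf_nonneg fun _ hA => hA.nonneg) hC1
    · rw [← div_le_iff₀' (by linarith)]
      refine le_csInf ⟨A, hA.isRbmoOneBound⟩ fun A hA => ?_
      rw [div_le_iff₀' (by linarith)]
      exact csInf_le hbdd (hA.isRbmoBound h hη hηα hN hΛ hfi)
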